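/- For $t\in\mathbb{C}\setminus\{0\}$ and $\nu\in\mathbb{C}$ let $$J_\nu(t)=\Big(\frac t2\Big)^{\nu}\sum_{k=0}^{\infty}\frac{(-1)^k (t/2)^{2k}}{k!\,\Gamma(\nu+k+1)}$$ be the Bessel function of the first kind (principal value of the power, $\arg t\in(-\pi,\pi]$; $1/\Gamma$ is taken to be $0$ at the poles of $\Gamma$), and let $$Y_\nu(t)=\frac{J_\nu(t)\cos(\nu\pi)-J_{-\nu}(t)}{\sin(\nu\pi)}\quad(\nu\notin\mathbb{Z}),\qquad Y_n(t)=\lim_{\nu\to n}Y_\nu(t)\quad(n\in\mathbb{Z})$$ be the Bessel function of the second kind. Theorem. Let $t\in\mathbb{C}$, $t\neq 0$. Then $\nu\mapsto J_\nu(t)$ and $\nu\mapsto Y_\nu(t)$ are differentiable on all of $\mathbb{C}$ (hence entire), and for every integer $m\ge 0$ $$\left.\frac{\partial^2 J_\nu(t)}{\partial\nu^2}\right|_{\nu=m}+(-1)^{m+1}\left.\frac{\partial^2 J_\nu(t)}{\partial\nu^2}\right|_{\nu=-m}=2\pi\left.\frac{\partial Y_\nu(t)}{\partial\nu}\right|_{\nu=m}+\pi^2J_m(t).$$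 Moreover, in closed form, $$\left.\frac{\partial^2 J_\nu(t)}{\partial\nu^2}\right|_{\nu=m}+(-1)^{m+1}\left.\frac{\partial^2 J_\nu(t)}{\partial\nu^2}\right|_{\nu=-m}=\pi\,m!\sum_{k=0}^{m-1}\frac{Y_k(t)}{k!\,(m-k)}\Big(\frac t2\Big)^{k-m}.$$ -/

import Mathlib

/-- The Bessel function of the first kind `J_ν(t)` of complex order `ν`, for `t ≠ 0`:
`J_ν(t) = (t/2)^ν ∑_{k ≥ 0} (-1)^k (t/2)^(2k) / (k! Γ(ν + k + 1))`, where `(t/2)^ν` is the principal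
power. The reciprocal Gamma function is entire and vanishes at the poles of `Γ`; this is what
`(Complex.Gamma s)⁻¹` gives, since Mathlib sets `Γ` to be `0` at its poles. -/
noncomputable def besselJ (ν t : ℂ) : ℂ :=
  (t / 2) ^ ν *
    ∑' k : ℕ, (-1 : ℂ) ^ k * (t / 2) ^ (2 * k) / (k.factorial : ℂ) *
      (Complex.Gamma (ν + k + 1))⁻¹

/-- The quotient `(J_ν(t) cos(νπ) - J_{-ν}(t)) / sin(νπ)`, meaningful for `ν ∉ ℤ`. -/
noncomputable def besselYQuotient (ν t : ℂ) : ℂ :=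
  (besselJ ν t * Complex.cos (ν * Real.pi) - besselJ (-ν) t) / Complex.sin (ν * Real.pi)

open scoped Topology Classical in
/-- The Bessel function of the second kind `Y_ν(t)` of complex order `ν`, for `t ≠ 0`:
the quotient `(J_ν(t) cos(νπ) - J_{-ν}(t)) / sin(νπ)` for `ν ∉ ℤ`, and its limit
as the order tends to `ν` for `ν ∈ ℤ`. -/
noncomputable def besselY (ν t : ℂ) : ℂ :=
  if ∃ n : ℤ, ν = (n : ℂ) then Filter.limUnder (𝓝[≠] ν) (fun μ : ℂ => besselYQuotient μ t)
  else besselYQuotient ν t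

/-! Both sides of `Y_ν sin(πν) = J_ν cos(πν) - J_{-ν}` are entire in `ν`, so the relation can be
differentiated at integers. At `ν = m` the sine vanishes and the cosine is `(-1)^m`: one derivative
gives `π Y_m = J'_m + (-1)^m J'_{-m}`, two give the reflection formula (`deriv_deriv_reflection`).
For the closed form let `A_m` be the left side and `x = t/2`. Differentiating the three-term
recurrence of `J` twice in `ν` gives `A_m + A_{m+2} = (m+1)/x A_{m+1} + 2π/x Y_{m+1}`, with `A_0 =
0` and `A_1 = π Y_0/x`. The finite sum solves the same problem (`sum_div_sub_recurrence`), because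
`Y_k` satisfies the homogeneous recurrence. -/

open Filter Topology

/-! ### The series and its analyticity in the order -/

/-- The `k`-th term of the power series defining `besselJ`, in terms of `x = t / 2`. -/
noncomputable def besselJTerm (x ν : ℂ) (k : ℕ) : ℂ :=
  (-1 : ℂ) ^ k * x ^ (2 * k) / (k.factorial : ℂ) * (Complex.Gamma (ν + k + 1))⁻¹

theorem besselJ_eq_tsum (ν t : ℂ) :
    besselJ ν t = (t / 2) ^ ν * ∑' k : ℕ, besselJTerm (t / 2) ν k := rfl

theorem Complex.inv_Gamma_eq_mul (s : ℂ) :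
    (Complex.Gamma s)⁻¹ = s * (Complex.Gamma (s + 1))⁻¹ :=
  Complex.one_div_Gamma_eq_self_mul_one_div_Gamma_add_one s

/-- The functions `1 / Γ(s + k + 1)`, `k ∈ ℕ`, are uniformly bounded on each ball. -/
theorem Complex.exists_norm_inv_Gamma_add_nat_le (R : ℝ) :
    ∃ C : ℝ, ∀ k : ℕ, ∀ s ∈ Metric.closedBall (0 : ℂ) R,
      ‖(Complex.Gamma (s + k + 1))⁻¹‖ ≤ C := by
  have hk (k : ℕ) : ∃ C : ℝ, ∀ s ∈ Metric.closedBall (0 : ℂ) R,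
      ‖(Complex.Gamma (s + k + 1))⁻¹‖ ≤ C := by
    refine (isCompact_closedBall (0 : ℂ) R).exists_bound_of_continuousOn ?_
    have h := Complex.differentiable_one_div_Gamma.continuous
    exact (h.comp (by fun_prop : Continuous fun s : ℂ => s + k + 1)).continuousOn
  choose M hM using hk
  obtain ⟨N, hN⟩ := exists_nat_ge (R + 1)
  have hfin : ∃ C, ∀ k ≤ N, M k ≤ C := by
    refine ⟨∑ k ∈ Finset.range (N + 1), |M k|, fun k hk => (le_abs_self _).trans ?_⟩
    exact Finset.single_le_sum (f := fun k => |M k|) (fun i _ => abs_nonneg _)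
      (Finset.mem_range.2 (by omega))
  obtain ⟨C, hC⟩ := hfin
  refine ⟨C, fun k s hs => ?_⟩
  rcases le_total k N with h | h
  · exact (hM k s hs).trans (hC k h)
  · induction k, h using Nat.le_induction with
    | base => exact (hM N s hs).trans (hC N le_rfl)
    -- Beyond `N` the functional equation divides by `s + k + 1`, of norm at least 1, so the bound
    -- persists.
    | succ k hk ih =>
      rw [Complex.inv_Gamma_eq_mul, norm_mul] at ih
      have h1 : 1 ≤ ‖s + k + 1‖ := by
        have hs' : ‖s‖ ≤ R := by simpa using hs
        have hkN : (N : ℝ) ≤ k := by exact_mod_cast hk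
        have h2 := norm_sub_norm_le ((k : ℂ) + 1) (-s)
        have h3 : ‖(k : ℂ) + 1‖ = k + 1 := by
          have := Complex.norm_natCast (k + 1)
          push_cast at this
          exact this
        rw [norm_neg, h3, sub_neg_eq_add] at h2
        rw [show s + k + 1 = k + 1 + s by ring]
        linarith
      rw [show s + ((k + 1 : ℕ) : ℂ) + 1 = s + k + 1 + 1 by push_cast; ring]
      exact (le_mul_of_one_le_left (norm_nonneg _) h1).trans ih

theorem exists_summable_bound_besselJTerm (x : ℂ) (R : ℝ) :
    ∃ u : ℕ → ℝ, Summable u ∧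
      ∀ k : ℕ, ∀ ν ∈ Metric.closedBall (0 : ℂ) R, ‖besselJTerm x ν k‖ ≤ u k := by
  obtain ⟨C, hC⟩ := Complex.exists_norm_inv_Gamma_add_nat_le R
  refine ⟨fun k => (‖x‖ ^ 2) ^ k / k.factorial * C,
    (Real.summable_pow_div_factorial (‖x‖ ^ 2)).mul_right C, fun k ν hν => ?_⟩
  have h : ‖(-1 : ℂ) ^ k * x ^ (2 * k) / (k.factorial : ℂ)‖ = (‖x‖ ^ 2) ^ k / k.factorial := by
    simp [pow_mul]
  rw [besselJTerm, norm_mul, h]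
  exact mul_le_mul_of_nonneg_left (hC k ν hν) (by positivity)

theorem summable_besselJTerm (x ν : ℂ) : Summable (besselJTerm x ν) := by
  obtain ⟨u, hu, h⟩ := exists_summable_bound_besselJTerm x ‖ν‖
  exact Summable.of_norm_bounded hu fun k => h k ν (by simp)

theorem differentiable_tsum_besselJTerm (x : ℂ) :
    Differentiable ℂ fun ν => ∑' k : ℕ, besselJTerm x ν k := by
  intro ν
  obtain ⟨u, hu, h⟩ := exists_summable_bound_besselJTerm x (‖ν‖ + 1)
  have hd : DifferentiableOn ℂ (fun ν => ∑' k : ℕ, besselJTerm x ν k)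
      (Metric.ball 0 (‖ν‖ + 1)) := by
    refine Complex.differentiableOn_tsum_of_summable_norm hu (fun k => ?_) Metric.isOpen_ball
      fun k w hw => h k w (Metric.ball_subset_closedBall hw)
    have hG : Differentiable ℂ fun ν : ℂ => (Complex.Gamma (ν + k + 1))⁻¹ :=
      Complex.differentiable_one_div_Gamma.comp
        (by fun_prop : Differentiable ℂ fun ν : ℂ => ν + k + 1)
    exact (hG.const_mul _).differentiableOn
  exact hd.differentiableAt (Metric.isOpen_ball.mem_nhds (by simp))

theorem differentiable_besselJ {t : ℂ} (ht : t ≠ 0) : Differentiable ℂ fun ν => besselJ ν t := by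
  have hx : t / 2 ≠ 0 := div_ne_zero ht two_ne_zero
  have h1 : Differentiable ℂ fun ν : ℂ => (t / 2) ^ ν :=
    fun ν => differentiableAt_id.const_cpow (Or.inl hx)
  exact h1.mul (differentiable_tsum_besselJTerm (t / 2))

/-! ### Recurrence in the order -/

theorem besselJTerm_sub_one_zero (x ν : ℂ) : besselJTerm x (ν - 1) 0 = ν * besselJTerm x ν 0 := by
  simp [besselJTerm, Complex.inv_Gamma_eq_mul ν]

/-- Split the factor `ν + k + 1` from the Gamma functional equation: `ν` keeps the order, while `k +
1` cancels in `(k + 1)!` and raises it. -/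
theorem besselJTerm_sub_one_succ (x ν : ℂ) (k : ℕ) :
    besselJTerm x (ν - 1) (k + 1)
      = ν * besselJTerm x ν (k + 1) - x ^ 2 * besselJTerm x (ν + 1) k := by
  have hk : (k.factorial : ℂ) ≠ 0 := by exact_mod_cast k.factorial_ne_zero
  have hk1 : (k : ℂ) + 1 ≠ 0 := by exact_mod_cast k.succ_ne_zero
  simp only [besselJTerm, Nat.factorial_succ]
  push_cast
  rw [show ν - 1 + (k + 1 : ℂ) + 1 = ν + k + 1 by ring, Complex.inv_Gamma_eq_mul (ν + k + 1),
    show ν + (k + 1 : ℂ) + 1 = ν + k + 1 + 1 by ring, show ν + 1 + (k : ℂ) + 1 = ν + k + 1 + 1 by ring]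
  field_simp
  ring

/-- The three-term recurrence in the order. -/
theorem besselJ_sub_one_add_besselJ_add_one {t : ℂ} (ht : t ≠ 0) (ν : ℂ) :
    besselJ (ν - 1) t + besselJ (ν + 1) t = ν / (t / 2) * besselJ ν t := by
  have hx : t / 2 ≠ 0 := div_ne_zero ht two_ne_zero
  simp only [besselJ_eq_tsum, Complex.cpow_sub _ _ hx, Complex.cpow_add _ _ hx, Complex.cpow_one]
  generalize t / 2 = x at *
  have hs (μ : ℂ) := (summable_nat_add_iff 1).2 (summable_besselJTerm x μ)
  have key : ∑' k, besselJTerm x (ν - 1) k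
      = ν * ∑' k, besselJTerm x ν k - x ^ 2 * ∑' k, besselJTerm x (ν + 1) k := by
    rw [(summable_besselJTerm x (ν - 1)).tsum_eq_zero_add,
      (summable_besselJTerm x ν).tsum_eq_zero_add, besselJTerm_sub_one_zero]
    simp only [besselJTerm_sub_one_succ]
    rw [((hs ν).mul_left ν).tsum_sub ((summable_besselJTerm x (ν + 1)).mul_left _),
      tsum_mul_left, tsum_mul_left]
    ring
  rw [key]
  field_simp
  ring

/-! ### Integer orders and analyticity of `Y` -/

theorem besselJTerm_neg_nat_of_lt (x : ℂ) {n k : ℕ} (h : k < n) : besselJTerm x (-n) k = 0 := by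
  obtain ⟨j, rfl⟩ := Nat.exists_eq_add_of_lt h
  have : -((k + j + 1 : ℕ) : ℂ) + k + 1 = -(j : ℂ) := by push_cast; ring
  simp only [besselJTerm]
  rw [this, Complex.Gamma_neg_nat_eq_zero, inv_zero, mul_zero]

theorem besselJTerm_neg_nat_add (x : ℂ) (n k : ℕ) :
    besselJTerm x (-n) (k + n) = (-1) ^ n * x ^ (2 * n) * besselJTerm x n k := by
  simp only [besselJTerm]
  rw [show -(n : ℂ) + ((k + n : ℕ) : ℂ) + 1 = (k : ℂ) + 1 by push_cast; ring,
    show (n : ℂ) + k + 1 = ((k + n : ℕ) : ℂ) + 1 by push_cast; ring,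
    Complex.Gamma_nat_eq_factorial, Complex.Gamma_nat_eq_factorial]
  ring

theorem besselJ_neg_nat {t : ℂ} (ht : t ≠ 0) (n : ℕ) :
    besselJ (-n) t = (-1) ^ n * besselJ n t := by
  have hx : t / 2 ≠ 0 := div_ne_zero ht two_ne_zero
  simp only [besselJ_eq_tsum, Complex.cpow_neg, Complex.cpow_natCast]
  generalize t / 2 = x at *
  rw [← (summable_besselJTerm x (-n)).sum_add_tsum_nat_add n,
    Finset.sum_eq_zero fun k hk => besselJTerm_neg_nat_of_lt x (Finset.mem_range.1 hk)]
  simp only [besselJTerm_neg_nat_add, tsum_mul_left]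
  field_simp
  ring

theorem besselJ_mul_cos_sub_besselJ_neg_int {t : ℂ} (ht : t ≠ 0) (n : ℤ) :
    besselJ n t * Complex.cos (n * Real.pi) - besselJ (-n) t = 0 := by
  have hc (m : ℕ) : Complex.cos (m * Real.pi) = (-1) ^ m := by
    exact_mod_cast congrArg ((↑) : ℝ → ℂ) (Real.cos_nat_mul_pi m)
  obtain ⟨m, rfl | rfl⟩ := n.eq_nat_or_neg
  · rw [Int.cast_natCast, besselJ_neg_nat ht, hc]
    ring
  · rw [Int.cast_neg, Int.cast_natCast, neg_neg, besselJ_neg_nat ht, neg_mul, Complex.cos_neg, hc,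
      mul_right_comm, ← mul_pow]
    simp

/-- The numerator and denominator of `besselYQuotient` have a removable common zero at each
integer: `besselY` is, near an integer, a quotient of difference quotients. -/
theorem eventually_besselY_eq_div_dslope {t : ℂ} (ht : t ≠ 0) (n : ℤ) :
    let f : ℂ → ℂ := fun ν => besselJ ν t * Complex.cos (ν * Real.pi) - besselJ (-ν) t
    let g : ℂ → ℂ := fun ν => Complex.sin (ν * Real.pi)
    Differentiable ℂ (dslope f n) ∧ Differentiable ℂ (dslope g n) ∧ dslope g n n ≠ 0 ∧
      ∀ᶠ ν in 𝓝 (n : ℂ), besselY ν t = dslope f n ν / dslope g n ν := by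
  intro f g
  have hJ := differentiable_besselJ ht
  have hf : Differentiable ℂ f :=
    (hJ.mul (by fun_prop)).sub (hJ.comp (differentiable_id.neg))
  have hg : Differentiable ℂ g := by fun_prop
  have hdf : Differentiable ℂ (dslope f n) := by
    rw [← differentiableOn_univ] at hf ⊢
    exact (Complex.differentiableOn_dslope univ_mem).2 hf
  have hdg : Differentiable ℂ (dslope g n) := by
    rw [← differentiableOn_univ] at hg ⊢
    exact (Complex.differentiableOn_dslope univ_mem).2 hg
  have hfn : f n = 0 := besselJ_mul_cos_sub_besselJ_neg_int ht n
  have hgn : g n = 0 := Complex.sin_int_mul_pi n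
  have hgn' : dslope g n n ≠ 0 := by
    have h1 : HasDerivAt g (Complex.cos (n * Real.pi) * (1 * Real.pi)) n :=
      (Complex.hasDerivAt_sin _).comp (n : ℂ) ((hasDerivAt_id (n : ℂ)).mul_const (Real.pi : ℂ))
    rw [dslope_same, h1.deriv, one_mul]
    refine mul_ne_zero (fun h => ?_) (by exact_mod_cast Real.pi_ne_zero)
    have h2 := Complex.sin_sq_add_cos_sq ((n : ℂ) * Real.pi)
    rw [h, Complex.sin_int_mul_pi] at h2
    simp at h2
  have hq (ν : ℂ) (hν : ν ≠ n) : besselYQuotient ν t = dslope f n ν / dslope g n ν := by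
    rw [dslope_of_ne _ hν, dslope_of_ne _ hν, slope_def_field, slope_def_field, hfn, hgn,
      sub_zero, sub_zero, div_div_div_cancel_right₀ (sub_ne_zero.2 hν)]
    rfl
  refine ⟨hdf, hdg, hgn', ?_⟩
  have hcont : ContinuousAt (fun ν => dslope f n ν / dslope g n ν) n :=
    hdf.continuous.continuousAt.div hdg.continuous.continuousAt hgn'
  have hlim : Tendsto (fun ν => besselYQuotient ν t) (𝓝[≠] (n : ℂ))
      (𝓝 (dslope f n n / dslope g n n)) :=
    (hcont.tendsto.mono_left nhdsWithin_le_nhds).congr'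
      (eventually_nhdsWithin_of_forall fun ν hν => (hq ν hν).symm)
  -- The unit ball around `n` contains no other integer.
  filter_upwards [Metric.ball_mem_nhds (n : ℂ) one_pos] with ν hν
  by_cases h : ν = n
  · subst h
    rw [besselY, if_pos ⟨n, rfl⟩, hlim.limUnder_eq]
  · rw [besselY, if_neg, hq ν h]
    rintro ⟨k, rfl⟩
    rw [Metric.mem_ball, dist_eq_norm, ← Int.cast_sub, Complex.norm_intCast] at hν
    have hk : |k - n| < 1 := by exact_mod_cast hν
    exact h (by rw [sub_eq_zero.1 (Int.abs_lt_one_iff.1 hk)])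

theorem sin_mul_pi_ne_zero {ν : ℂ} (h : ¬ ∃ n : ℤ, ν = n) : Complex.sin (ν * Real.pi) ≠ 0 := by
  rw [Complex.sin_ne_zero_iff]
  intro k hk
  exact h ⟨k, mul_right_cancel₀ (by exact_mod_cast Real.pi_ne_zero) hk⟩

theorem differentiable_besselY {t : ℂ} (ht : t ≠ 0) : Differentiable ℂ fun ν => besselY ν t := by
  intro ν
  by_cases h : ∃ n : ℤ, ν = n
  · obtain ⟨n, rfl⟩ := h
    obtain ⟨hf, hg, hne, heq⟩ := eventually_besselY_eq_div_dslope ht n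
    exact ((hf _).div (hg _) hne).congr_of_eventuallyEq heq
  · have hJ := differentiable_besselJ ht
    have hd : DifferentiableAt ℂ (fun ν => besselYQuotient ν t) ν :=
      ((hJ.mul (by fun_prop)).sub (hJ.comp differentiable_id.neg) ν).div
        (by fun_prop) (sin_mul_pi_ne_zero h)
    have hsin : ∀ᶠ μ : ℂ in 𝓝 ν, Complex.sin (μ * Real.pi) ≠ 0 :=
      (by fun_prop : Continuous fun μ : ℂ => Complex.sin (μ * Real.pi)).continuousAt.eventually_ne
        (sin_mul_pi_ne_zero h)
    refine hd.congr_of_eventuallyEq ?_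
    filter_upwards [hsin] with μ hμ
    rw [besselY, if_neg]
    rintro ⟨n, rfl⟩
    exact hμ (Complex.sin_int_mul_pi n)

/-- At integers both sides vanish whatever the value of `Y`, so no exceptional orders obstruct
differentiation. -/
theorem besselY_mul_sin {t : ℂ} (ht : t ≠ 0) (ν : ℂ) :
    besselY ν t * Complex.sin (ν * Real.pi)
      = besselJ ν t * Complex.cos (ν * Real.pi) - besselJ (-ν) t := by
  by_cases h : ∃ n : ℤ, ν = n
  · obtain ⟨n, rfl⟩ := h
    rw [besselJ_mul_cos_sub_besselJ_neg_int ht, Complex.sin_int_mul_pi, mul_zero]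
  · rw [besselY, if_neg h, besselYQuotient, div_mul_cancel₀ _ (sin_mul_pi_ne_zero h)]

/-! ### Differentiating the connection formula and the recurrence -/

theorem hasDerivAt_deriv_deriv {f : ℂ → ℂ} (hf : Differentiable ℂ f) (z : ℂ) :
    HasDerivAt (deriv f) (deriv (deriv f) z) z := by
  rw [← differentiableOn_univ] at hf
  exact ((hf.deriv isOpen_univ).differentiableAt univ_mem).hasDerivAt

theorem hasDerivAt_cos_mul_pi (ν : ℂ) :
    HasDerivAt (fun ν : ℂ => Complex.cos (ν * Real.pi))
      (-(Real.pi * Complex.sin (ν * Real.pi))) ν := by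
  have h := (Complex.hasDerivAt_cos (ν * Real.pi)).comp ν
    ((hasDerivAt_id ν).mul_const (Real.pi : ℂ))
  exact h.congr_deriv (by ring)

theorem hasDerivAt_sin_mul_pi (ν : ℂ) :
    HasDerivAt (fun ν : ℂ => Complex.sin (ν * Real.pi))
      (Real.pi * Complex.cos (ν * Real.pi)) ν := by
  have h := (Complex.hasDerivAt_sin (ν * Real.pi)).comp ν
    ((hasDerivAt_id ν).mul_const (Real.pi : ℂ))
  exact h.congr_deriv (by ring)

theorem HasDerivAt.comp_neg_arg {f : ℂ → ℂ} {f' ν : ℂ} (h : HasDerivAt f f' (-ν)) :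
    HasDerivAt (fun ν => f (-ν)) (-f') ν :=
  (h.comp ν (hasDerivAt_neg ν)).congr_deriv (by ring)

section OrderDerivatives

variable {J Y : ℂ → ℂ}

theorem deriv_mul_sin_add_mul_cos (hJ : Differentiable ℂ J) (hY : Differentiable ℂ Y)
    (h : ∀ ν : ℂ, Y ν * Complex.sin (ν * Real.pi) = J ν * Complex.cos (ν * Real.pi) - J (-ν))
    (ν : ℂ) :
    deriv Y ν * Complex.sin (ν * Real.pi) + Y ν * (Real.pi * Complex.cos (ν * Real.pi))
      = deriv J ν * Complex.cos (ν * Real.pi) - J ν * (Real.pi * Complex.sin (ν * Real.pi))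
        + deriv J (-ν) := by
  have h1 := (hY ν).hasDerivAt.mul (hasDerivAt_sin_mul_pi ν)
  have h2 := ((hJ ν).hasDerivAt.mul (hasDerivAt_cos_mul_pi ν)).sub (hJ (-ν)).hasDerivAt.comp_neg_arg
  have h3 := h1.unique (h2.congr_of_eventuallyEq (Eventually.of_forall h))
  rw [h3]
  ring

theorem deriv_deriv_mul_sin_add (hJ : Differentiable ℂ J) (hY : Differentiable ℂ Y)
    (h : ∀ ν : ℂ, Y ν * Complex.sin (ν * Real.pi) = J ν * Complex.cos (ν * Real.pi) - J (-ν))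
    (ν : ℂ) :
    deriv (deriv Y) ν * Complex.sin (ν * Real.pi)
        + 2 * Real.pi * deriv Y ν * Complex.cos (ν * Real.pi)
        - Real.pi ^ 2 * Y ν * Complex.sin (ν * Real.pi)
      = deriv (deriv J) ν * Complex.cos (ν * Real.pi)
        - 2 * Real.pi * deriv J ν * Complex.sin (ν * Real.pi)
        - Real.pi ^ 2 * J ν * Complex.cos (ν * Real.pi) - deriv (deriv J) (-ν) := by
  have hs := hasDerivAt_sin_mul_pi ν
  have hc := hasDerivAt_cos_mul_pi ν
  have h1 := ((hasDerivAt_deriv_deriv hY ν).mul hs).add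
    ((hY ν).hasDerivAt.mul (hc.const_mul (Real.pi : ℂ)))
  have h2 := (((hasDerivAt_deriv_deriv hJ ν).mul hc).sub
    ((hJ ν).hasDerivAt.mul (hs.const_mul (Real.pi : ℂ)))).add
      (hasDerivAt_deriv_deriv hJ (-ν)).comp_neg_arg
  have h3 := h1.unique (h2.congr_of_eventuallyEq
    (Eventually.of_forall (deriv_mul_sin_add_mul_cos hJ hY h)))
  linear_combination h3

theorem cos_nat_mul_pi_complex (m : ℕ) : Complex.cos (m * Real.pi) = (-1) ^ m := by
  exact_mod_cast congrArg ((↑) : ℝ → ℂ) (Real.cos_nat_mul_pi m)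

theorem neg_one_pow_mul_self_complex (m : ℕ) : (-1 : ℂ) ^ m * (-1) ^ m = 1 := by
  rw [← mul_pow]; simp

theorem pi_mul_eq_deriv_add_deriv_neg (hJ : Differentiable ℂ J) (hY : Differentiable ℂ Y)
    (h : ∀ ν : ℂ, Y ν * Complex.sin (ν * Real.pi) = J ν * Complex.cos (ν * Real.pi) - J (-ν))
    (m : ℕ) : Real.pi * Y m = deriv J m + (-1) ^ m * deriv J (-m) := by
  have h1 := deriv_mul_sin_add_mul_cos hJ hY h m
  rw [cos_nat_mul_pi_complex, Complex.sin_nat_mul_pi] at h1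
  linear_combination (-1) ^ m * h1 + (deriv J m - Real.pi * Y m) * neg_one_pow_mul_self_complex m

theorem deriv_deriv_reflection (hJ : Differentiable ℂ J) (hY : Differentiable ℂ Y)
    (h : ∀ ν : ℂ, Y ν * Complex.sin (ν * Real.pi) = J ν * Complex.cos (ν * Real.pi) - J (-ν))
    (m : ℕ) :
    deriv (deriv J) m + (-1) ^ (m + 1) * deriv (deriv J) (-m)
      = 2 * Real.pi * deriv Y m + Real.pi ^ 2 * J m := by
  have h1 := deriv_deriv_mul_sin_add hJ hY h m
  rw [cos_nat_mul_pi_complex, Complex.sin_nat_mul_pi] at h1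
  linear_combination (-(-1) ^ m) * h1 +
    (2 * Real.pi * deriv Y m + Real.pi ^ 2 * J m - deriv (deriv J) m) *
      neg_one_pow_mul_self_complex m

variable {x : ℂ}

theorem deriv_sub_one_add_deriv_add_one (hJ : Differentiable ℂ J)
    (hr : ∀ ν, J (ν - 1) + J (ν + 1) = ν / x * J ν) (ν : ℂ) :
    deriv J (ν - 1) + deriv J (ν + 1) = 1 / x * J ν + ν / x * deriv J ν := by
  have h1 := ((hJ (ν - 1)).hasDerivAt.comp_sub_const ν 1).add
    ((hJ (ν + 1)).hasDerivAt.comp_add_const ν 1)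
  have h2 := ((hasDerivAt_id ν).div_const x).mul (hJ ν).hasDerivAt
  exact h1.unique (h2.congr_of_eventuallyEq (Eventually.of_forall hr))

theorem deriv_deriv_sub_one_add_deriv_deriv_add_one (hJ : Differentiable ℂ J)
    (hr : ∀ ν, J (ν - 1) + J (ν + 1) = ν / x * J ν) (ν : ℂ) :
    deriv (deriv J) (ν - 1) + deriv (deriv J) (ν + 1)
      = 2 / x * deriv J ν + ν / x * deriv (deriv J) ν := by
  have h1 := ((hasDerivAt_deriv_deriv hJ (ν - 1)).comp_sub_const ν 1).add
    ((hasDerivAt_deriv_deriv hJ (ν + 1)).comp_add_const ν 1)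
  have h2 := ((hJ ν).hasDerivAt.const_mul (1 / x)).add
    (((hasDerivAt_id ν).div_const x).mul (hasDerivAt_deriv_deriv hJ ν))
  rw [h1.unique (h2.congr_of_eventuallyEq
    (Eventually.of_forall (deriv_sub_one_add_deriv_add_one hJ hr)))]
  simp only [id]
  ring

/-- Differentiate the recurrence of `J` at `±(m + 1)`; the extra terms `J_{m+1}/x` and `J_{-m-1}/x`
cancel by the connection formula at `m + 1`. -/
theorem order_recurrence_nat_of_reflection (hJ : Differentiable ℂ J) (hY : Differentiable ℂ Y)
    (h : ∀ ν : ℂ, Y ν * Complex.sin (ν * Real.pi) = J ν * Complex.cos (ν * Real.pi) - J (-ν))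
    (hr : ∀ ν, J (ν - 1) + J (ν + 1) = ν / x * J ν) (m : ℕ) :
    Y m + Y (m + 2 : ℕ) = (m + 1 : ℕ) / x * Y (m + 1 : ℕ) := by
  have hpi : (Real.pi : ℂ) ≠ 0 := by exact_mod_cast Real.pi_ne_zero
  refine mul_left_cancel₀ hpi ?_
  have e0 := pi_mul_eq_deriv_add_deriv_neg hJ hY h m
  have e1 := pi_mul_eq_deriv_add_deriv_neg hJ hY h (m + 1)
  have e2 := pi_mul_eq_deriv_add_deriv_neg hJ hY h (m + 2)
  have r1 := deriv_sub_one_add_deriv_add_one hJ hr (m + 1 : ℕ)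
  have r2 := deriv_sub_one_add_deriv_add_one hJ hr (-(m + 1 : ℕ))
  have hJm := h (m + 1 : ℕ)
  rw [cos_nat_mul_pi_complex, Complex.sin_nat_mul_pi] at hJm
  rw [show ((m + 1 : ℕ) : ℂ) - 1 = m by push_cast; ring,
    show ((m + 1 : ℕ) : ℂ) + 1 = (m + 2 : ℕ) by push_cast; ring] at r1
  rw [show -((m + 1 : ℕ) : ℂ) - 1 = -(m + 2 : ℕ) by push_cast; ring,
    show -((m + 1 : ℕ) : ℂ) + 1 = -m by push_cast; ring] at r2
  have hsq := neg_one_pow_mul_self_complex m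
  rw [pow_succ] at e1 hJm
  rw [pow_add] at e2
  linear_combination e0 + e2 - (m + 1 : ℕ) / x * e1 + r1 + (-1) ^ m * r2 +
    1 / x * (-1) ^ m * hJm - 1 / x * J (m + 1 : ℕ) * hsq

/-- The first-derivative terms at `±(m + 1)` combine to a multiple of `Y_{m+1}`, the source term. -/
theorem second_deriv_combination_recurrence (hJ : Differentiable ℂ J) (hY : Differentiable ℂ Y)
    (h : ∀ ν : ℂ, Y ν * Complex.sin (ν * Real.pi) = J ν * Complex.cos (ν * Real.pi) - J (-ν))
    (hr : ∀ ν, J (ν - 1) + J (ν + 1) = ν / x * J ν) (m : ℕ) :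
    let A : ℕ → ℂ := fun m => deriv (deriv J) m + (-1) ^ (m + 1) * deriv (deriv J) (-m)
    A m + A (m + 2) = (m + 1 : ℕ) / x * A (m + 1) + 2 * Real.pi / x * Y (m + 1 : ℕ) := by
  intro A
  have e1 := pi_mul_eq_deriv_add_deriv_neg hJ hY h (m + 1)
  have r1 := deriv_deriv_sub_one_add_deriv_deriv_add_one hJ hr (m + 1 : ℕ)
  have r2 := deriv_deriv_sub_one_add_deriv_deriv_add_one hJ hr (-(m + 1 : ℕ))
  rw [show ((m + 1 : ℕ) : ℂ) - 1 = m by push_cast; ring,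
    show ((m + 1 : ℕ) : ℂ) + 1 = (m + 2 : ℕ) by push_cast; ring] at r1
  rw [show -((m + 1 : ℕ) : ℂ) - 1 = -(m + 2 : ℕ) by push_cast; ring,
    show -((m + 1 : ℕ) : ℂ) + 1 = -m by push_cast; ring] at r2
  simp only [A]
  simp only [pow_succ] at e1 ⊢
  linear_combination r1 - (-1) ^ m * r2 - 2 / x * e1

theorem second_deriv_combination_one (hJ : Differentiable ℂ J) (hY : Differentiable ℂ Y)
    (h : ∀ ν : ℂ, Y ν * Complex.sin (ν * Real.pi) = J ν * Complex.cos (ν * Real.pi) - J (-ν))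
    (hr : ∀ ν, J (ν - 1) + J (ν + 1) = ν / x * J ν) :
    deriv (deriv J) 1 + deriv (deriv J) (-1) = Real.pi / x * Y 0 := by
  have e := pi_mul_eq_deriv_add_deriv_neg hJ hY h 0
  have r := deriv_deriv_sub_one_add_deriv_deriv_add_one hJ hr 0
  simp only [Nat.cast_zero, pow_zero, neg_zero, zero_sub, zero_add, zero_div] at e r
  linear_combination r - 1 / x * e

end OrderDerivatives

/-! ### Solving the inhomogeneous recurrence -/

/-- The weighted sums `∑_{k < m} y_k / (m - k)` of a solution of the scaled order recurrence
again satisfy that recurrence, with an inhomogeneity. -/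
theorem sum_div_sub_recurrence {K : Type*} [Field K] [CharZero K] {q : K} {y : ℕ → K}
    (hy : ∀ k : ℕ, (k + 2) * y (k + 2) + q * y k / (k + 1) = (k + 1) * y (k + 1)) (m : ℕ) :
    let S : ℕ → K := fun m => ∑ k ∈ Finset.range m, y k / ((m : K) - k)
    (m + 2) * S (m + 2) + q / (m + 1) * S m = (m + 1) * S (m + 1) + 2 * y (m + 1) := by
  intro S
  have ne (k : ℕ) : (k : K) + 1 ≠ 0 := by exact_mod_cast k.succ_ne_zero
  have hsub {a b : ℕ} (hab : b < a) : (a : K) - b ≠ 0 :=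
    sub_ne_zero.2 (by exact_mod_cast hab.ne')
  -- Write `n = (n - k) + k` in each numerator.
  have weighted (n : ℕ) : (n : K) * S n
      = ∑ k ∈ Finset.range n, y k + ∑ k ∈ Finset.range n, k * y k / ((n : K) - k) := by
    simp only [S]
    rw [Finset.mul_sum, ← Finset.sum_add_distrib]
    refine Finset.sum_congr rfl fun k hk => ?_
    have := hsub (Finset.mem_range.1 hk)
    field_simp
    ring
  have w1 := weighted (m + 1)
  have w2 := weighted (m + 2)
  rw [Finset.sum_range_succ _ (m + 1), Finset.sum_range_succ' (fun k => (k : K) * y k / _)] at w2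
  -- After the index shift the denominators agree; `hy` turns each numerator into `-q y_k/(k+1)`,
  -- and partial fractions split `1/((k+1)(m-k))`.
  have shift : ∑ k ∈ Finset.range (m + 1),
        ((k + 1 : ℕ) : K) * y (k + 1) / (((m + 2 : ℕ) : K) - (k + 1 : ℕ))
      - ∑ k ∈ Finset.range (m + 1), k * y k / (((m + 1 : ℕ) : K) - k)
      = y 1 / (m + 1) - q / (m + 1) * (∑ k ∈ Finset.range m, y k / (k + 1) + S m) := by
    simp only [S]
    rw [← Finset.sum_sub_distrib, Finset.sum_range_succ', ← Finset.sum_add_distrib, Finset.mul_sum,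
      sub_eq_neg_add (y 1 / _), ← Finset.sum_neg_distrib]
    congr 1
    · refine Finset.sum_congr rfl fun k hk => ?_
      have h1 := hsub (Finset.mem_range.1 hk)
      have h2 := ne k
      have h3 := ne m
      have h4 := hy k
      push_cast
      rw [show (m : K) + 2 - (k + 1 + 1) = m - k by ring, show (m : K) + 1 - (k + 1) = m - k by ring,
        show (k : K) + 1 + 1 = k + 2 by ring, show k + 1 + 1 = k + 2 from rfl]
      field_simp at h4 ⊢
      linear_combination (m + 1) * h4
    · push_cast
      simp only [zero_mul, zero_div, sub_zero, one_mul]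
      congr 1
      ring
  have tele : q * ∑ k ∈ Finset.range m, y k / (k + 1) = y 1 - (m + 1) * y (m + 1) := by
    have := Finset.sum_range_sub' (fun k : ℕ => ((k : K) + 1) * y (k + 1)) m
    simp only [Nat.cast_zero, zero_add, one_mul] at this
    rw [← this, Finset.mul_sum]
    refine Finset.sum_congr rfl fun k _ => ?_
    have h4 := hy k
    push_cast
    rw [show (k : K) + 1 + 1 = k + 2 by ring, show k + 1 + 1 = k + 2 from rfl]
    linear_combination h4
  have hm := ne m
  simp only [Nat.cast_zero, zero_mul, zero_div, add_zero] at w2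
  push_cast at w1 w2 shift
  have tele' : q / (m + 1) * ∑ k ∈ Finset.range m, y k / (k + 1) = y 1 / (m + 1) - y (m + 1) := by
    rw [div_mul_eq_mul_div, tele]
    field_simp
  linear_combination w2 - w1 + shift - tele'

/-- A solution of the inhomogeneous order recurrence in closed form. -/
theorem eq_factorial_mul_sum_of_recurrence {x c : ℂ} (hx : x ≠ 0) {A Y : ℕ → ℂ}
    (hY : ∀ m : ℕ, Y m + Y (m + 2) = (m + 1 : ℕ) / x * Y (m + 1))
    (hA : ∀ m : ℕ, A m + A (m + 2) = (m + 1 : ℕ) / x * A (m + 1) + 2 * c / x * Y (m + 1))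
    (hA0 : A 0 = 0) (hA1 : A 1 = c / x * Y 0) (m : ℕ) :
    A m = c * m.factorial * ∑ k ∈ Finset.range m,
      Y k / ((k.factorial : ℂ) * ((m : ℂ) - k)) * x ^ ((k : ℤ) - m) := by
  have ne (k : ℕ) : (k : ℂ) + 1 ≠ 0 := by exact_mod_cast k.succ_ne_zero
  have hfac (k : ℕ) : (k.factorial : ℂ) ≠ 0 := by exact_mod_cast k.factorial_ne_zero
  -- This scaling reduces the sum to `∑ y_k/(m-k)` with prefactor `c m!/x^m`, and gives the
  -- recurrence with `q = x^2`.
  set y : ℕ → ℂ := fun k => Y k * x ^ k / k.factorial with hy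
  have yrec (k : ℕ) : (k + 2) * y (k + 2) + x ^ 2 * y k / (k + 1) = (k + 1) * y (k + 1) := by
    have h1 := hY k
    have h2 := ne k
    have h3 := hfac k
    have h4 : (k : ℂ) + 2 ≠ 0 := by exact_mod_cast (k + 1).succ_ne_zero
    have h5 : (k : ℂ) + 1 + 1 ≠ 0 := by rwa [add_assoc, one_add_one_eq_two]
    simp only [hy, Nat.factorial_succ]
    push_cast at h1 ⊢
    field_simp at h1 ⊢
    linear_combination x ^ (k + 1) * (k + 2) * h1
  have hsum (m : ℕ) : c * m.factorial * ∑ k ∈ Finset.range m,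
      Y k / ((k.factorial : ℂ) * ((m : ℂ) - k)) * x ^ ((k : ℤ) - m)
      = c * m.factorial / x ^ m * ∑ k ∈ Finset.range m, y k / ((m : ℂ) - k) := by
    rw [div_eq_mul_inv _ (x ^ m), mul_assoc _ (x ^ m)⁻¹, Finset.mul_sum _ _ (x ^ m)⁻¹]
    congr 1
    refine Finset.sum_congr rfl fun k _ => ?_
    rw [zpow_sub₀ hx, zpow_natCast, zpow_natCast]
    simp only [hy, div_eq_mul_inv, mul_inv]
    ring
  rw [hsum]
  have srec (m : ℕ) := sum_div_sub_recurrence yrec m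
  simp only at srec
  induction m using Nat.twoStepInduction with
  | zero => simp [hA0]
  | one => simp [hA1, hy]
  | more m ih0 ih1 =>
    have h1 := hA m
    have h2 := srec m
    rw [ih0, ih1] at h1
    generalize ∑ k ∈ Finset.range m, y k / ((m : ℂ) - k) = S0 at *
    generalize ∑ k ∈ Finset.range (m + 1), y k / (((m + 1 : ℕ) : ℂ) - k) = S1 at *
    generalize ∑ k ∈ Finset.range (m + 2), y k / (((m + 2 : ℕ) : ℂ) - k) = S2 at *
    have h3 := ne m
    have h4 := hfac m
    have hYy : Y (m + 1) = (m + 1) * m.factorial / x ^ (m + 1) * y (m + 1) := by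
      simp only [hy, Nat.factorial_succ]
      push_cast
      field_simp
    rw [hYy] at h1
    have hS2 : A (m + 2) = (m + 1) / x * (c * ((m + 1) * m.factorial) / x ^ (m + 1) * S1)
        + 2 * c / x * ((m + 1) * m.factorial / x ^ (m + 1) * y (m + 1))
        - c * m.factorial / x ^ m * S0 := by
      simp only [Nat.factorial_succ] at h1
      push_cast at h1
      linear_combination h1
    rw [hS2]
    simp only [Nat.factorial_succ]
    push_cast
    field_simp at h2 ⊢
    linear_combination (-c * x ^ (2 * m + 2)) * h2

theorem mainTheorem3 (t : ℂ) (ht : t ≠ 0) :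
    -- the order derivatives below exist
    Differentiable ℂ (fun ν : ℂ => besselJ ν t) ∧
    Differentiable ℂ (fun ν : ℂ => besselY ν t) ∧
    ∀ m : ℕ,
      -- the reflection formula
      iteratedDeriv 2 (fun ν : ℂ => besselJ ν t) (m : ℂ)
          + (-1 : ℂ) ^ (m + 1) * iteratedDeriv 2 (fun ν : ℂ => besselJ ν t) (-(m : ℂ))
        = 2 * (Real.pi : ℂ) * deriv (fun ν : ℂ => besselY ν t) (m : ℂ)
          + (Real.pi : ℂ) ^ 2 * besselJ (m : ℂ) t ∧
      -- its closed form
      iteratedDeriv 2 (fun ν : ℂ => besselJ ν t) (m : ℂ)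
          + (-1 : ℂ) ^ (m + 1) * iteratedDeriv 2 (fun ν : ℂ => besselJ ν t) (-(m : ℂ))
        = (Real.pi : ℂ) * (m.factorial : ℂ) *
          ∑ k ∈ Finset.range m,
            besselY (k : ℂ) t / ((k.factorial : ℂ) * ((m : ℂ) - (k : ℂ))) *
              (t / 2) ^ ((k : ℤ) - (m : ℤ)) := by
  have hx : t / 2 ≠ 0 := div_ne_zero ht two_ne_zero
  have hJ := differentiable_besselJ ht
  have hY := differentiable_besselY ht
  have h := besselY_mul_sin ht
  have hr := besselJ_sub_one_add_besselJ_add_one ht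
  simp only [iteratedDeriv_succ, iteratedDeriv_zero]
  refine ⟨hJ, hY, fun m => ⟨deriv_deriv_reflection hJ hY h m, ?_⟩⟩
  refine eq_factorial_mul_sum_of_recurrence (Y := fun k : ℕ => besselY k t)
    (A := fun m : ℕ => deriv (deriv fun ν => besselJ ν t) m
      + (-1) ^ (m + 1) * deriv (deriv fun ν => besselJ ν t) (-m)) hx
    (order_recurrence_nat_of_reflection hJ hY h hr)
    (second_deriv_combination_recurrence hJ hY h hr) (by simp) ?_ m
  simpa using second_deriv_combination_one hJ hY h hr
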